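/- Let $q$ be a prime power, let $n,m,t$ be non-negative integers with $m\ge n+1$ and $t<n$, and fix an $\mathbb F_q$-linear identification of $\mathbb F_{q^m}$ with $\mathbb F_q^m$, so that a vector of $\mathbb F_{q^m}^n$ becomes an $m\times n$ matrix over $\mathbb F_q$; the rank distance of $\mathbf x,\mathbf y\in\mathbb F_{q^m}^n$ is the rank of the matrix of $\mathbf y-\mathbf x$. An $\mathbb F_{q^m}$-linear code $\mathcal C\subseteq\mathbb F_{q^m}^n$ has parameters $[n,k,d]_{q^m}$ if its dimension over $\mathbb F_{q^m}$ is $k$ and its minimum rank distance is $d$, and it is maximum rank distance (MRD) if $k+d=n+1$. Then there exist an MRD code $\mathcal C\subseteq\mathbb F_{q^m}^n$ of parameters $[n,t+1,n-t]_{q^m}$ and a vector $\mathbf h\in\mathbb F_{q^m}^n$ such that, for all $\boldsymbol\lambda^{(1)},\dots,\boldsymbol\lambda^{(t)}\in\mathbb F_q^n$ and for $\mathbf x$ uniformly random in $\mathcal C$, the value $\mathbf h\mathbf x^T$ is completely undetermined even if $\boldsymbol\lambda^{(1)}\mathbf x^T,\dots,\boldsymbol\lambda^{(t)}\mathbf x^T$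 are known: conditioned on any value that the tuple $(\boldsymbol\lambda^{(1)}\mathbf x^T,\dots,\boldsymbol\lambda^{(t)}\mathbf x^T)$ takes with positive probability, $\mathbf h\mathbf x^T$ is uniformly distributed on $\mathbb F_{q^m}$. -/

import Mathlib

/-- The `m × n` matrix over `F` of a vector `x ∈ K^n`, under an identification `φ` of the field
`K` with `F^m`: the `j`-th column is the expansion of `x j`. -/
def expansionMatrix {F K : Type*} [Field F] [Field K] [Algebra F K] {m n : ℕ}
    (φ : K ≃ₗ[F] (Fin m → F)) (x : Fin n → K) : Matrix (Fin m) (Fin n) F :=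
  Matrix.of fun i j => φ (x j) i

/-- The rank distance on `K^n`. -/
noncomputable def rankDist {F K : Type*} [Field F] [Field K] [Algebra F K] {m n : ℕ}
    (φ : K ≃ₗ[F] (Fin m → F)) (x y : Fin n → K) : ℕ :=
  (expansionMatrix φ y - expansionMatrix φ x).rank

/-- The `K`-linear rank-metric code `C` of length `n` has dimension `k` and minimum rank
distance `d`. -/
structure HasRankParameters {F K : Type*} [Field F] [Field K] [Algebra F K] {m n : ℕ}
    (φ : K ≃ₗ[F] (Fin m → F)) (C : Submodule K (Fin n → K)) (k d : ℕ) : Prop where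
  dim_eq : Module.finrank K C = k
  minDist : IsLeast {r : ℕ | ∃ x ∈ C, ∃ y ∈ C, x ≠ y ∧ rankDist φ x y = r} d

/-- Maximum rank distance codes: `k + d = n + 1`. -/
def IsMRD {F K : Type*} [Field F] [Field K] [Algebra F K] {m n : ℕ}
    (φ : K ≃ₗ[F] (Fin m → F)) (C : Submodule K (Fin n → K)) : Prop :=
  ∃ k d : ℕ, HasRankParameters φ C k d ∧ k + d = n + 1

/-- The law of a uniformly random codeword of `C`. -/
noncomputable def uniformCodeword {K : Type*} [Field K] [Finite K] {n : ℕ}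
    (C : Submodule K (Fin n → K)) : PMF C :=
  letI : Fintype C := Fintype.ofFinite C
  PMF.uniformOfFintype C

/-- For `ω` drawn from `p`, the value `secret ω` is completely undetermined when `view ω` is
known: conditioned on any value that `view ω` takes with positive probability, `secret ω` is
uniformly distributed on the whole of `β`. -/
def CompletelyUndetermined {Ω α β : Type*} [Fintype β] [Nonempty β]
    (p : PMF Ω) (secret : Ω → β) (view : Ω → α) : Prop :=
  ∀ (a : α) (ha : ∃ ω ∈ {ω | view ω = a}, ω ∈ p.support),
    (p.filter {ω | view ω = a} ha).map secret = PMF.uniformOfFintype β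

/-! The code is a Gabidulin code: evaluate the linearized maps `f` of `q`-degree at most `t` at `n`
points `g j` independent over `F`. Since `m ≥ n + 1`, there is a further point `b` outside their
span, and the secret is `f b`. By `F`-linearity, each observed combination is the value of `f` at a
point of the span of `g`, so the observer knows `f` on a space of dimension at most `t` not
containing `b`. Some `f` vanishes there but not at `b` (`exists_linearizedMap_vanishing`); adding
its multiples moves the secret freely without changing the view. -/

open Polynomial in
/-- The linearized polynomial `∑ i, c i * X ^ (q ^ i)`, with `q = |F|`. -/
noncomputable def linearizedPoly (F : Type*) {K : Type*} [Fintype F] [Field K] {k : ℕ}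
    (c : Fin k → K) : K[X] :=
  ∑ i, C (c i) * X ^ (Fintype.card F ^ (i : ℕ))

/-- The `F`-linear map `a ↦ ∑ i, c i * a ^ (q ^ i)`, with `q = |F|`. -/
noncomputable def linearizedMap (F : Type*) {K : Type*} [Field F] [Fintype F] [Field K]
    [Algebra F K] {k : ℕ} (c : Fin k → K) : K →ₗ[F] K :=
  ∑ i, c i • ((FiniteField.frobeniusAlgHom F K) ^ (i : ℕ)).toLinearMap

/-! ### Root counting and interpolation for linearized maps. -/

section Linearized

variable {F K : Type*} [Field F] [Fintype F] [Field K] {k : ℕ}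

theorem coeff_linearizedPoly (c : Fin k → K) (i : Fin k) :
    (linearizedPoly F c).coeff (Fintype.card F ^ (i : ℕ)) = c i := by
  have hinj := Nat.pow_right_injective (Fintype.one_lt_card (α := F))
  simp only [linearizedPoly, Polynomial.finsetSum_coeff, Polynomial.coeff_C_mul,
    Polynomial.coeff_X_pow]
  rw [Finset.sum_eq_single i]
  · simp
  · intro j _ hj
    rw [if_neg, mul_zero]
    exact fun h => hj (Fin.ext (hinj h).symm)
  · simp

theorem linearizedPoly_ne_zero {c : Fin k → K} (hc : c ≠ 0) : linearizedPoly F c ≠ 0 := by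
  intro h
  refine hc (funext fun i => ?_)
  rw [← coeff_linearizedPoly (F := F) c i, h]
  simp

theorem natDegree_linearizedPoly_le (c : Fin (k + 1) → K) :
    (linearizedPoly F c).natDegree ≤ Fintype.card F ^ k := by
  refine Polynomial.natDegree_sum_le_of_forall_le _ _ fun i _ => ?_
  refine (Polynomial.natDegree_C_mul_X_pow_le _ _).trans ?_
  exact Nat.pow_le_pow_right Fintype.card_pos (Nat.lt_succ_iff.mp i.isLt)

variable [Algebra F K]

theorem linearizedMap_apply (c : Fin k → K) (a : K) :
    linearizedMap F c a = ∑ i, c i * a ^ (Fintype.card F ^ (i : ℕ)) := by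
  simp [linearizedMap, AlgHom.coe_pow, FiniteField.coe_frobeniusAlgHom, pow_iterate]

theorem eval_linearizedPoly (c : Fin k → K) (a : K) :
    (linearizedPoly F c).eval a = linearizedMap F c a := by
  simp [linearizedPoly, linearizedMap_apply, Polynomial.eval_finsetSum]

theorem linearizedMap_snoc_zero (c : Fin k → K) :
    linearizedMap F (Fin.snoc c 0 : Fin (k + 1) → K) = linearizedMap F c := by
  ext a
  simp [linearizedMap_apply, Fin.sum_univ_castSucc]

/-- Evaluation of linearized maps at the points `g j`, as a linear map in the coefficients. -/
noncomputable def gabidulinMap (F : Type*) {K : Type*} [Field F] [Fintype F] [Field K]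
    [Algebra F K] {ι : Type*} (k : ℕ) (g : ι → K) : (Fin k → K) →ₗ[K] (ι → K) where
  toFun c j := linearizedMap F c (g j)
  map_add' c d := by
    ext j
    simp [linearizedMap_apply, add_mul, Finset.sum_add_distrib]
  map_smul' r c := by
    ext j
    simp [linearizedMap_apply, mul_assoc, Finset.mul_sum]

@[simp]
theorem gabidulinMap_apply {ι : Type*} (g : ι → K) (c : Fin k → K) (j : ι) :
    gabidulinMap F k g c j = linearizedMap F c (g j) := rfl

variable [Fintype K]

/-- The kernel consists of roots of a nonzero polynomial of degree at most `q ^ k`. -/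
theorem finrank_ker_linearizedMap_le {c : Fin (k + 1) → K} (hc : c ≠ 0) :
    Module.finrank F (LinearMap.ker (linearizedMap F c)) ≤ k := by
  classical
  have hp := linearizedPoly_ne_zero (F := F) hc
  let Z : Finset K := Finset.univ.filter (· ∈ LinearMap.ker (linearizedMap F c))
  have hZ : Z.card ≤ Fintype.card F ^ k := by
    refine le_trans (Polynomial.card_le_degree_of_subset_roots (p := linearizedPoly F c) ?_)
      (natDegree_linearizedPoly_le c)
    intro a ha
    have ha' : linearizedMap F c a = 0 := by simpa [Z] using ha
    rw [Polynomial.mem_roots hp, Polynomial.IsRoot, eval_linearizedPoly, ha']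
  have hcard : Z.card = Fintype.card F ^ Module.finrank F (LinearMap.ker (linearizedMap F c)) := by
    rw [← Module.card_eq_pow_finrank, ← Fintype.card_subtype]
  rw [hcard] at hZ
  exact (Nat.pow_le_pow_iff_right Fintype.one_lt_card).mp hZ

/-- A subspace of dimension at most `k` is separated from any point outside it by a linearized
map of `q`-degree at most `k`. -/
theorem exists_linearizedMap_vanishing (W : Submodule F K) {b : K} (hb : b ∉ W)
    (hW : Module.finrank F W ≤ k) :
    ∃ c : Fin (k + 1) → K, W ≤ LinearMap.ker (linearizedMap F c) ∧ linearizedMap F c b ≠ 0 := by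
  induction k, hW using Nat.le_induction with
  | base =>
    -- There is one more coefficient than there are vanishing conditions; the kernel bound then
    -- forces the kernel to be exactly `W`.
    let v := Module.finBasis F W
    have hker : LinearMap.ker (gabidulinMap F (Module.finrank F W + 1)
        (fun j => (v j : K))) ≠ ⊥ := by
      apply LinearMap.ker_ne_bot_of_finrank_lt
      simp
    obtain ⟨c, hc, hc0⟩ := Submodule.exists_mem_ne_zero_of_ne_bot hker
    have hWc : W ≤ LinearMap.ker (linearizedMap F c) := by
      have h : linearizedMap F c ∘ₗ W.subtype = 0 :=
        v.ext fun j => congrFun (LinearMap.mem_ker.mp hc) j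
      exact fun w hw => LinearMap.congr_fun h ⟨w, hw⟩
    refine ⟨c, hWc, fun hbc => ?_⟩
    have hlt : W < LinearMap.ker (linearizedMap F c) :=
      lt_of_le_of_ne hWc fun h => hb (h ▸ LinearMap.mem_ker.mpr hbc)
    exact absurd (Submodule.finrank_lt_finrank_of_lt hlt)
      (not_lt.mpr (finrank_ker_linearizedMap_le hc0))
  | succ k _ ih =>
    obtain ⟨c, h1, h2⟩ := ih
    exact ⟨Fin.snoc c 0, by rwa [linearizedMap_snoc_zero], by rwa [linearizedMap_snoc_zero]⟩

end Linearized

/-! ### Rank of Gabidulin codewords. -/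

section Rank

variable {F K : Type*} [Field F] [Field K] [Algebra F K] {m n : ℕ}

theorem expansionMatrix_sub (φ : K ≃ₗ[F] (Fin m → F)) (x y : Fin n → K) :
    expansionMatrix φ y - expansionMatrix φ x = expansionMatrix φ (y - x) := by
  ext i j
  simp [expansionMatrix]

theorem rank_expansionMatrix (φ : K ≃ₗ[F] (Fin m → F)) (x : Fin n → K) :
    (expansionMatrix φ x).rank =
      Module.finrank F (LinearMap.range (Fintype.linearCombination F x)) := by
  have h : (expansionMatrix φ x).mulVecLin =
      φ.toLinearMap ∘ₗ Fintype.linearCombination F x := by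
    ext j i
    simp [expansionMatrix, Fintype.linearCombination_apply]
  rw [Matrix.rank, h, LinearMap.range_comp]
  exact LinearEquiv.finrank_map_eq φ _

/-- A vector with `t` zero coordinates has rank at most `n - t`. -/
theorem rank_expansionMatrix_le (φ : K ≃ₗ[F] (Fin m → F)) (x : Fin n → K) {t : ℕ} (ht : t ≤ n)
    (hx : ∀ i : Fin t, x (Fin.castLE ht i) = 0) : (expansionMatrix φ x).rank ≤ n - t := by
  classical
  let s : Finset (Fin n) := (Finset.univ.map (Fin.castLEEmb ht))ᶜ
  have hs : s.card = n - t := by simp [s, Finset.card_compl]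
  rw [← Matrix.rank_transpose, ← hs]
  refine Matrix.rank_le_card_of_support_subset _ s fun j hj => ?_
  by_contra hjs
  obtain ⟨i, rfl⟩ : ∃ i, Fin.castLE ht i = j :=
    ⟨⟨j, by simpa [s] using hjs⟩, rfl⟩
  apply hj
  ext l
  simp [expansionMatrix, hx]

theorem linearCombination_gabidulinMap [Fintype F] {k : ℕ} (g : Fin n → K) (c : Fin k → K) :
    Fintype.linearCombination F (gabidulinMap F k g c) =
      linearizedMap F c ∘ₗ Fintype.linearCombination F g := by
  ext j
  simp

/-- Nonzero words of a Gabidulin code have rank at least `n - k`. -/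
theorem le_rank_gabidulinMap [Fintype F] [Fintype K] (φ : K ≃ₗ[F] (Fin m → F)) {k : ℕ}
    {g : Fin n → K} (hg : LinearIndependent F g) {c : Fin (k + 1) → K} (hc : c ≠ 0) :
    n - k ≤ (expansionMatrix φ (gabidulinMap F (k + 1) g c)).rank := by
  rw [rank_expansionMatrix, linearCombination_gabidulinMap]
  have hinj : Function.Injective (Fintype.linearCombination F g) :=
    hg.fintypeLinearCombination_injective
  have hker : Module.finrank F (LinearMap.ker
      (linearizedMap F c ∘ₗ Fintype.linearCombination F g)) ≤ k := by
    rw [LinearMap.ker_comp]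
    refine le_trans ?_ (finrank_ker_linearizedMap_le (F := F) hc)
    -- Independence of `g` embeds this kernel into that of `linearizedMap F c`.
    rw [LinearEquiv.finrank_eq (Submodule.equivMapOfInjective _ hinj _)]
    exact Submodule.finrank_mono (Submodule.map_comap_le _ _)
  have := LinearMap.finrank_range_add_finrank_ker
    (linearizedMap F c ∘ₗ Fintype.linearCombination F g)
  rw [Module.finrank_fin_fun] at this
  omega

theorem gabidulinMap_injective [Fintype F] [Fintype K] {k : ℕ} {g : Fin n → K}
    (hg : LinearIndependent F g) (hk : k < n) :
    Function.Injective (gabidulinMap F (k + 1) g) := by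
  rw [injective_iff_map_eq_zero]
  intro c hc
  by_contra hc0
  have h := le_rank_gabidulinMap (Module.finBasis F K).equivFun hg hc0
  have h0 : expansionMatrix (Module.finBasis F K).equivFun (0 : Fin n → K) = 0 := by
    ext
    simp [expansionMatrix]
  rw [hc, h0, Matrix.rank_zero] at h
  omega

end Rank

/-! ### Uniformity by translation. -/

section Uniform

theorem PMF.eq_uniformOfFintype_of_forall_eq {β : Type*} [Fintype β] [Nonempty β] (p : PMF β)
    (hp : ∀ a b, p a = p b) : p = PMF.uniformOfFintype β := by
  ext a
  have h1 : ∑ b, p b = 1 := by rw [← tsum_fintype (L := .unconditional β), p.tsum_coe]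
  rw [Finset.sum_congr rfl fun b _ => hp b a, Finset.sum_const, Finset.card_univ,
    nsmul_eq_mul] at h1
  rw [PMF.uniformOfFintype_apply]
  exact ENNReal.eq_inv_of_mul_eq_one_left (by rwa [mul_comm])

/-- A linear functional is completely undetermined, given a linear view, as soon as it does not
vanish on the kernel of the view. -/
theorem completelyUndetermined_of_linear {K : Type*} [Field K] [Fintype K] {n : ℕ} {V : Type*}
    [AddCommGroup V] [Module K V] (C : Submodule K (Fin n → K)) (s : C →ₗ[K] K) (L : C →ₗ[K] V)
    {x₀ : C} (hL : L x₀ = 0) (hs : s x₀ ≠ 0) :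
    CompletelyUndetermined (uniformCodeword C) s L := by
  classical
  intro a ha
  apply PMF.eq_uniformOfFintype_of_forall_eq
  intro u v
  -- This translation along `x₀` preserves the view and the uniform mass, and carries secret `u` to
  -- secret `v`.
  rw [PMF.map_apply, PMF.map_apply,
    ← (Equiv.addRight (((v - u) / s x₀) • x₀)).tsum_eq (fun x => if v = s x then _ else 0)]
  refine tsum_congr fun x => ?_
  have hsx : s (x + ((v - u) / s x₀) • x₀) = s x + (v - u) := by
    simp [div_mul_cancel₀ _ hs]
  have hiff : v = s x + (v - u) ↔ u = s x := by
    constructor <;> intro h <;> linear_combination h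
  simp only [Equiv.coe_addRight, hsx, hiff, PMF.filter_apply]
  congr 2
  simp [Set.indicator_apply, hL, uniformCodeword]

end Uniform

theorem mainTheorem8 {F K : Type*} [Field F] [Fintype F] [Field K] [Fintype K] [Algebra F K]
    (q m n t : ℕ) (hF : Fintype.card F = q) (hK : Fintype.card K = q ^ m)
    (φ : K ≃ₗ[F] (Fin m → F)) (hmn : n + 1 ≤ m) (htn : t < n) :
    ∃ (C : Submodule K (Fin n → K)) (h : Fin n → K),
      IsMRD φ C ∧ HasRankParameters φ C (t + 1) (n - t) ∧
      ∀ lam : Fin t → Fin n → F,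
        CompletelyUndetermined (uniformCodeword C)
          (fun x => ∑ j, h j * (x : Fin n → K) j)
          (fun x => fun i : Fin t => ∑ j, algebraMap F K (lam i j) * (x : Fin n → K) j) := by
  have hdim : Module.finrank F K = m := by rw [φ.finrank_eq, Module.finrank_fin_fun]
  obtain ⟨g, hg⟩ : ∃ g : Fin n → K, LinearIndependent F g :=
    exists_linearIndependent_of_le_finrank (by omega)
  obtain ⟨b, hgb⟩ := exists_linearIndependent_snoc_of_lt_finrank hg (by omega)
  have hb : b ∉ Submodule.span F (Set.range g) := (linearIndependent_finSnoc.mp hgb).2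
  have hE := gabidulinMap_injective hg htn
  have hsep : ∀ a : Fin t → K, (∀ i, a i ∈ Submodule.span F (Set.range g)) →
      ∃ c : Fin (t + 1) → K, (∀ i, linearizedMap F c (a i) = 0) ∧ linearizedMap F c b ≠ 0 := by
    intro a ha
    obtain ⟨c, hc, hcb⟩ := exists_linearizedMap_vanishing (k := t)
      (Submodule.span F (Set.range a))
      (fun h => hb (Submodule.span_le.mpr (Set.range_subset_iff.mpr ha) h))
      ((finrank_range_le_card a).trans (Fintype.card_fin t).le)
    exact ⟨c, fun i => hc (Submodule.subset_span ⟨i, rfl⟩), hcb⟩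
  -- Any left inverse serves: it recovers `f` from a codeword, and `ℓ` then evaluates `f` at `b`.
  obtain ⟨r, hr⟩ := LinearMap.exists_leftInverse_of_injective _ (LinearMap.ker_eq_bot.mpr hE)
  have hr' : ∀ c, r (gabidulinMap F (t + 1) g c) = c := fun c => LinearMap.congr_fun hr c
  let ℓ : (Fin n → K) →ₗ[K] K :=
    LinearMap.proj () ∘ₗ gabidulinMap F (t + 1) (fun _ : Unit => b) ∘ₗ r
  have hℓ : ∀ x, ∑ j, ℓ (Pi.single j 1) * x j = ℓ x := by
    intro x
    rw [LinearMap.pi_apply_eq_sum_univ ℓ x]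
    refine Finset.sum_congr rfl fun j _ => ?_
    rw [smul_eq_mul, mul_comm]
    congr 2
    ext i
    simp [Pi.single_apply, eq_comm]
  have hpar : HasRankParameters φ (LinearMap.range (gabidulinMap F (t + 1) g))
      (t + 1) (n - t) := by
    refine ⟨by rw [LinearMap.finrank_range_of_inj hE, Module.finrank_fin_fun], ?_, ?_⟩
    -- A minimum-weight word: `f` vanishing at the first `t` points, and nonzero because `f b ≠ 0`.
    · obtain ⟨c, hc, hcb⟩ := hsep (fun i => g (Fin.castLE htn.le i))
        (fun i => Submodule.subset_span ⟨_, rfl⟩)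
      have hc0 : c ≠ 0 := by
        rintro rfl
        exact hcb (by simp [linearizedMap])
      refine ⟨0, zero_mem _, _, ⟨c, rfl⟩, ?_, ?_⟩
      · exact fun h => hc0 (hE (by rw [← h, map_zero]))
      · rw [rankDist, expansionMatrix_sub, sub_zero]
        exact le_antisymm (rank_expansionMatrix_le φ _ htn.le hc) (le_rank_gabidulinMap φ hg hc0)
    · rintro _ ⟨_, ⟨c, rfl⟩, _, ⟨d, rfl⟩, hne, rfl⟩
      rw [rankDist, expansionMatrix_sub, ← map_sub]
      exact le_rank_gabidulinMap φ hg (sub_ne_zero.mpr fun h => hne (by rw [h]))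
  refine ⟨LinearMap.range (gabidulinMap F (t + 1) g), fun j => ℓ (Pi.single j 1),
    ⟨t + 1, n - t, hpar, by omega⟩, hpar, fun lam => ?_⟩
  obtain ⟨c, hc, hcb⟩ := hsep (fun i => ∑ j, lam i j • g j)
    (fun i => Submodule.sum_mem _ fun j _ =>
      Submodule.smul_mem _ _ (Submodule.subset_span ⟨j, rfl⟩))
  let C := LinearMap.range (gabidulinMap F (t + 1) g)
  let L : (Fin n → K) →ₗ[K] (Fin t → K) :=
    LinearMap.pi fun i => ∑ j, algebraMap F K (lam i j) • LinearMap.proj j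
  have hL : ∀ x : Fin n → K, L x = fun i => ∑ j, algebraMap F K (lam i j) * x j := by
    intro x
    ext i
    simp [L, Algebra.smul_def]
  have key := completelyUndetermined_of_linear C (ℓ ∘ₗ C.subtype) (L ∘ₗ C.subtype)
    (x₀ := ⟨gabidulinMap F (t + 1) g c, c, rfl⟩) ?_ ?_
  · convert key using 1
    · ext x
      exact hℓ x
    · ext x : 1
      exact (hL x).symm
  · ext i
    have := hc i
    simp only [map_sum, map_smul] at this
    simpa [hL, Algebra.smul_def] using this
  · simpa [ℓ, hr'] using hcb
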